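/- \textbf{Proposition (Bayesian Regressing Counterfactual Mean Embedding).} Let $k_u,k_a$ be positive semidefinite kernels on sets $\mathcal U,\mathcal A$, put $\mathcal X=\mathcal U\times\mathcal A$ and $k_x((u,a),(u',a'))=k_u(u,u')\,k_a(a,a')$. Let $\mathcal H$ be a reproducing kernel Hilbert space of real functions on a measurable space $\mathcal Y$ with kernel $k$, let $\nu$ be a finite measure on $\mathcal Y$ with $k(y,\cdot)\in L^2(\nu)$ for every $y$, and let $r(y_1,y_2)=\int k(y_1,u)\,k(u,y_2)\,\nu(du)$. Let $\lambda,\lambda_f>0$ and let data sets $D_1=\{(x_i,r_i)\}_{i=1}^N\subset\mathcal X\times\mathcal Y$, $D_2=\{(\tilde r_j,y_j)\}_{j=1}^M\subset\mathcal Y\times\mathbb R$ and $D_3=\{x'_l\}_{l=1}^L\subset\mathcal X$, $L\ge1$, be given. Write $K$ for matrices of evaluations of $k_x$ (at the points $\mathbf x=(x_i)$, $\mathbf x'=(x'_l)$) or of $k$ (at the points $\mathbf r=(r_i)$, $\tilde{\mathbf r}=(\tilde r_j)$), and $R$ for matrices of evaluations of $r$, e.g. $(R_{\mathbf r\tilde{\mathbf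 r}})_{ij}=r(r_i,\tilde r_j)$. Assume that $R_{\mathbf r\mathbf r}$ is invertible. Let $f\in\mathcal H$ be the kernel ridge regressor learned from $D_2$, i.e. a minimizer over $g\in\mathcal H$ of $\sum_{j=1}^M(y_j-g(\tilde r_j))^2+\lambda_f\|g\|_{\mathcal H}^2$. Model the conditional mean embedding by an $\mathcal H$-valued random field $x\mapsto\mu_{gp}(x,\cdot)$ on a probability space, such that $(\mu_{gp}(x,y))_{(x,y)\in\mathcal X\times\mathcal Y}$ is a centered Gaussian process with covariance $k_x\otimes r$ (so its paths $\mu_{gp}(x,\cdot)$ lie in $\mathcal H$), and let $\epsilon_1,\dots,\epsilon_N$ be i.i.d. centered Gaussian processes on $\mathcal Y$ with covariance $r$, independent of $\mu_{gp}$. The regression model is $\phi_i=\mu_{gp}(x_i,\cdot)+\lambda^{1/2}\epsilon_i$, where the functions $\phi_i$ are observed at the points $r_1,\dots,r_N$, with observed values $\phi_i(r_j)=k(r_i,r_j)$. The counterfactual mean embedding is $\mu_{Y\langle0|1\rangle}=\frac1L\sum_{l=1}^L\mu_{gp}(x'_l,\cdot)$. Then the posterior distribution of $\eta=\langle f,\mu_{Y\langle0|1\rangle}\rangle_{\mathcal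 H}$ given these observations is $\mathcal N(\mu_2,\sigma_2^2)$, where \[ \mu_2=\tfrac1L\mathbf 1_L^\top K_{\mathbf x'\mathbf x}(K_{\mathbf x\mathbf x}+\lambda I)^{-1}K_{\mathbf r\mathbf r}R_{\mathbf r\mathbf r}^{-1}R_{\mathbf r\tilde{\mathbf r}}A, \] \[ \sigma_2^2=B\,\tfrac1{L^2}\mathbf 1_L^\top K_{\mathbf x'\mathbf x'}\mathbf 1_L-C\,\tfrac1{L^2}\mathbf 1_L^\top K_{\mathbf x'\mathbf x}(K_{\mathbf x\mathbf x}+\lambda I)^{-1}K_{\mathbf x\mathbf x'}\mathbf 1_L\ \ge 0, \] with $A=(K_{\tilde{\mathbf r}\tilde{\mathbf r}}+\lambda_fI)^{-1}\mathbf y$, $\mathbf y=(y_1,\dots,y_M)^\top$, $B=A^\top R_{\tilde{\mathbf r}\tilde{\mathbf r}}A$ and $C=A^\top R_{\tilde{\mathbf r}\mathbf r}R_{\mathbf r\mathbf r}^{-1}R_{\mathbf r\tilde{\mathbf r}}A$ (a degenerate normal law is allowed). Here the posterior distribution at the observed value $z$ is the value at $z$ of a weakly continuous version of the regular conditional distribution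 of $\eta$ given the observations; such a version exists, and all such versions have the same value at $z$. -/

import Mathlib

open MeasureTheory ProbabilityTheory
open scoped ENNReal Matrix

noncomputable section

namespace BayesRCFME

/-- The real-valued reproducing kernel `k(y, y') = ⟨k(·, y), k(·, y')⟩` of a reproducing kernel
Hilbert space `H` of real functions on `Y`. -/
def rkhsKernel (H : Type*) {Y : Type*} [NormedAddCommGroup H] [InnerProductSpace ℝ H]
    [CompleteSpace H] [RKHS ℝ H Y ℝ] (y y' : Y) : ℝ :=
  RKHS.kernel H y y' 1

/-- The product kernel `k_u ⊗ k_a` on pairs `x = (u, a)`. -/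
def prodKernel {U A : Type*} (ku : U → U → ℝ) (ka : A → A → ℝ) (x x' : U × A) : ℝ :=
  ku x.1 x'.1 * ka x.2 x'.2

/-- The convolution of `k` with itself, `r(y, y') = ∫ k(y, u) k(u, y') ν(du)`. -/
def convKernel {Y : Type*} [MeasurableSpace Y] (k : Y → Y → ℝ) (ν : Measure Y) (y y' : Y) : ℝ :=
  ∫ u, k y u * k u y' ∂ν

/-- The matrix `(k(s_i, t_j))_{i,j}` of kernel evaluations. -/
def gram {X ι κ : Type*} (k : X → X → ℝ) (s : ι → X) (t : κ → X) : Matrix ι κ ℝ :=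
  Matrix.of fun i j => k (s i) (t j)

/-- `f` is a kernel ridge regressor in `H`, with regularization parameter `lamF`, for the data
`(r_j, y_j)`: it minimizes the regularized sum of squares over all of `H`. -/
def IsKernelRidgeRegressor {H Y ι : Type*} [NormedAddCommGroup H] [InnerProductSpace ℝ H]
    [RKHS ℝ H Y ℝ] [Fintype ι] (lamF : ℝ) (r : ι → Y) (y : ι → ℝ) (f : H) : Prop :=
  ∀ g : H, ∑ j, (y j - f (r j)) ^ 2 + lamF * ‖f‖ ^ 2 ≤ ∑ j, (y j - g (r j)) ^ 2 + lamF * ‖g‖ ^ 2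

/-- Under `P`, the process `X` is Gaussian with mean zero and covariance function `c`. -/
structure IsCenteredGP {Ω T : Type*} [MeasurableSpace Ω] (P : Measure Ω) (X : T → Ω → ℝ)
    (c : T → T → ℝ) : Prop where
  gaussian : IsGaussianProcess X P
  mean_eq_zero : ∀ t, ∫ ω, X t ω ∂P = 0
  cov_eq : ∀ s t, cov[X s, X t; P] = c s t

/-- The Bayesian regression model for the conditional mean embedding `x ↦ μ_{Y | X = x}`.
The random field `emb` takes its values in the RKHS `H`; its prior is `GP(0, kx ⊗ ry)`, the noise
functions `noise 1, …, noise N` are i.i.d. `GP(0, ry)`, and they are independent of the field. -/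
structure IsBayesCMEModel {Ω X Y H : Type*} [MeasurableSpace Ω] [NormedAddCommGroup H]
    [InnerProductSpace ℝ H] [RKHS ℝ H Y ℝ] {N : ℕ} (P : Measure Ω)
    (kx : X → X → ℝ) (ry : Y → Y → ℝ) (emb : X → Ω → H) (noise : Fin N → Y → Ω → ℝ) : Prop where
  prior : IsCenteredGP P (fun (p : X × Y) ω => emb p.1 ω p.2)
    (fun p q => kx p.1 q.1 * ry p.2 q.2)
  noise_gp : ∀ i, IsCenteredGP P (noise i) ry
  noise_indep : iIndepFun (fun i ω y => noise i y ω) P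
  prior_indep_noise : IndepFun (fun ω (p : X × Y) => emb p.1 ω p.2)
    (fun ω (q : Fin N × Y) => noise q.1 q.2 ω) P

/-- The observed functions `emb(x_i, ·) + √lam noise_i`, recorded at the points `r_j`. In the
regression they are equated with the feature functions `k(·, r_i)` at these points. -/
def observation {Ω X Y H : Type*} [NormedAddCommGroup H]
    [InnerProductSpace ℝ H] [RKHS ℝ H Y ℝ] {N : ℕ} (lam : ℝ) (emb : X → Ω → H)
    (noise : Fin N → Y → Ω → ℝ) (x : Fin N → X) (r : Fin N → Y) (ω : Ω) : Fin N → Fin N → ℝ :=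
  fun i j => emb (x i) ω (r j) + √lam * noise i (r j) ω

/-- The counterfactual mean embedding: the average of the conditional mean embeddings over the
sample `x'_1, …, x'_L`. -/
def counterfactualEmbedding {Ω X H : Type*} [NormedAddCommGroup H]
    [InnerProductSpace ℝ H] {L : ℕ} (emb : X → Ω → H) (x' : Fin L → X) (ω : Ω) : H :=
  (1 / (L : ℝ)) • ∑ l, emb (x' l) ω

/-- `κ` is a weakly continuous regular conditional distribution of `η` given `Z`. -/
structure IsContinuousCondDistrib {Ω E : Type*} [MeasurableSpace Ω] [MeasurableSpace E]
    [TopologicalSpace E] (P : Measure Ω) (Z : Ω → E) (η : Ω → ℝ) (κ : Kernel E ℝ)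
    [IsMarkovKernel κ] : Prop where
  continuous : Continuous (Y := ProbabilityMeasure ℝ) fun z => ⟨κ z, inferInstance⟩
  disintegrates : P.map (fun ω => (Z ω, η ω)) = (P.map Z) ⊗ₘ κ

/-- The posterior distribution of `η` given the observation `Z = z` is `ρ`: the variables are
measurable, a weakly continuous regular conditional distribution of `η` given `Z` exists and has
the value `ρ` at `z`, and every other one has the same value there. -/
def HasPosterior {Ω E : Type*} [MeasurableSpace Ω] [MeasurableSpace E] [TopologicalSpace E]
    (P : Measure Ω) (Z : Ω → E) (η : Ω → ℝ) (z : E) (ρ : Measure ℝ) : Prop :=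
  AEMeasurable Z P ∧ AEMeasurable η P ∧
    (∃ (κ : Kernel E ℝ) (_ : IsMarkovKernel κ), IsContinuousCondDistrib P Z η κ ∧ κ z = ρ) ∧
    ∀ (κ : Kernel E ℝ) (_ : IsMarkovKernel κ), IsContinuousCondDistrib P Z η κ → κ z = ρ

end BayesRCFME

end

namespace BayesRCFME

/-! By the representer theorem `f` is a combination of kernel sections with coefficients `A`, so the
reproducing property turns `η` into a finite linear combination of values of the field. It is
therefore jointly Gaussian with the observations.

The noise has the same covariance `r` in `y` as the prior, so the observations have covariance `Q ⊗
R` with `Q = Kxx + λI` and `R = Rrr`. Their covariance with `η` is the rank-one array `a ⊗ b`, where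
`a = (1/L) Kxx' 1` and `b = Rrr' A`. The regression weights are then `Q⁻¹a ⊗ R⁻¹b`; the residual is
uncorrelated with the observations, hence independent of them, and has variance `Var η -
(aᵀQ⁻¹a)(bᵀR⁻¹b) ≥ 0` (`exists_hasPosterior_of_hasGaussianLaw`).

Pointwise uniqueness of the posterior comes from full support: `Q ⊗ R` is positive definite, so the
law of the observations charges every nonempty open set, and continuous versions that agree almost
everywhere agree everywhere (`hasPosterior_of_indepFun`). -/

/-! ### Weakly continuous Gaussian conditional laws -/

/-- The kernel `z ↦ 𝒩(m z, v)`. -/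
noncomputable def gaussianKernel {E : Type*} [MeasurableSpace E] (m : E → ℝ) (hm : Measurable m)
    (v : NNReal) : Kernel E ℝ where
  toFun z := gaussianReal (m z) v
  measurable' := by
    refine Measure.measurable_of_measurable_coe _ fun s hs => ?_
    have h : (fun z => gaussianReal (m z) v s) =
        fun z => gaussianReal 0 v (Prod.mk z ⁻¹' ((fun p : E × ℝ => m p.1 + p.2) ⁻¹' s)) := by
      funext z
      rw [← zero_add (m z), ← gaussianReal_map_const_add, Measure.map_apply (by fun_prop) hs]
      simp [Set.preimage]
    rw [h]
    exact measurable_measure_prodMk_left (by measurability)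

lemma gaussianKernel_apply {E : Type*} [MeasurableSpace E] (m : E → ℝ) (hm : Measurable m)
    (v : NNReal) (z : E) : gaussianKernel m hm v z = gaussianReal (m z) v := rfl

instance {E : Type*} [MeasurableSpace E] (m : E → ℝ) (hm : Measurable m) (v : NNReal) :
    IsMarkovKernel (gaussianKernel m hm v) :=
  ⟨fun z => by rw [gaussianKernel_apply]; infer_instance⟩

/-- Normal laws depend weakly continuously on their mean. -/
lemma continuous_gaussianKernel {E : Type*} [MeasurableSpace E] [TopologicalSpace E] {m : E → ℝ}
    (hm : Measurable m) (hmc : Continuous m) (v : NNReal) :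
    Continuous (Y := ProbabilityMeasure ℝ) fun z => ⟨gaussianKernel m hm v z, inferInstance⟩ := by
  have h : Continuous (Y := ProbabilityMeasure ℝ) fun a : ℝ => ⟨gaussianReal a v, inferInstance⟩ := by
    refine continuous_iff_continuousAt.2 fun a => ?_
    refine ProbabilityMeasure.tendsto_iff_forall_integral_tendsto.2 fun g => ?_
    -- Translating moves the mean into the bounded continuous integrand, so dominated convergence
    -- applies with the sup norm as bound.
    have hint : ∀ b : ℝ, ∫ x, g x ∂(gaussianReal b v) = ∫ x, g (b + x) ∂(gaussianReal 0 v) := by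
      intro b
      rw [← zero_add b, ← gaussianReal_map_const_add, integral_map (by fun_prop)
        g.continuous.aestronglyMeasurable, zero_add]
    simp only [ProbabilityMeasure.coe_mk, hint]
    refine (continuous_of_dominated (bound := fun _ => ‖g‖) (fun b => ?_) (fun b => ?_) ?_ ?_).tendsto a
    · exact (g.continuous.comp (by fun_prop)).aestronglyMeasurable
    · exact .of_forall fun x => g.norm_coe_le_norm _
    · exact integrable_const _
    · exact .of_forall fun x => g.continuous.comp (by fun_prop)
  exact h.comp hmc

/-- If `η = m(Z) + ξ` with `ξ ∼ 𝒩(0, v)` independent of `Z`, and the law of `Z` charges every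
nonempty open set, then the posterior distribution of `η` given `Z = z` is `𝒩(m(z), v)`. -/
theorem hasPosterior_of_indepFun {Ω E : Type*} [MeasurableSpace Ω] [MeasurableSpace E]
    [TopologicalSpace E] [OpensMeasurableSpace E] {P : Measure Ω} [IsProbabilityMeasure P]
    {Z : Ω → E} {η ξ : Ω → ℝ} {m : E → ℝ} {v : NNReal} (hZ : AEMeasurable Z P)
    (hm : Continuous m) (hpos : (P.map Z).IsOpenPosMeasure) (hξm : AEMeasurable ξ P)
    (hξ : P.map ξ = gaussianReal 0 v) (hind : IndepFun Z ξ P)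
    (hη : ∀ ω, η ω = m (Z ω) + ξ ω) (z : E) :
    HasPosterior P Z η z (gaussianReal (m z) v) := by
  have hηm : AEMeasurable η P := by
    rw [funext hη]
    exact (hm.measurable.comp_aemeasurable hZ).add hξm
  have hPZ : IsProbabilityMeasure (P.map Z) := Measure.isProbabilityMeasure_map hZ
  have hκ : IsContinuousCondDistrib P Z η (gaussianKernel m hm.measurable v) := by
    refine ⟨continuous_gaussianKernel _ hm v, ?_⟩
    have hφ : Measurable fun p : E × ℝ => (p.1, m p.1 + p.2) := by
      have := hm.measurable
      fun_prop
    -- By independence the joint law is the image of a product measure under the shear `(z, t) ↦ (z,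
    -- m z + t)`.
    have hmap : P.map (fun ω => (Z ω, η ω)) =
        ((P.map Z).prod (gaussianReal 0 v)).map (fun p : E × ℝ => (p.1, m p.1 + p.2)) := by
      rw [← hξ, ← (indepFun_iff_map_prod_eq_prod_map_map hZ hξm).1 hind,
        AEMeasurable.map_map_of_aemeasurable hφ.aemeasurable (hZ.prodMk hξm)]
      simp only [Function.comp_def, hη]
    rw [hmap]
    refine Measure.ext_of_lintegral _ fun g hg => ?_
    rw [lintegral_map hg hφ, Measure.lintegral_compProd hg,
      lintegral_prod (fun p : E × ℝ => g (p.1, m p.1 + p.2)) (hg.comp hφ).aemeasurable]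
    refine lintegral_congr fun a => ?_
    rw [gaussianKernel_apply, ← zero_add (m a), ← gaussianReal_map_const_add,
      lintegral_map (by fun_prop) (by fun_prop)]
  refine ⟨hZ, hηm, ⟨_, inferInstance, hκ, rfl⟩, fun κ _ h => ?_⟩
  have hae := Kernel.ae_eq_of_compProd_eq (h.disintegrates.symm.trans hκ.disintegrates)
  have heq := ((h.continuous.ae_eq_iff_eq (P.map Z) hκ.continuous).1 (by
    filter_upwards [hae] with a ha
    exact Subtype.ext ha))
  exact congrArg Subtype.val (congrFun heq z)

/-! ### Kernels of the RKHS and kernel ridge regression -/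

section RKHS

variable {H Y : Type*} [NormedAddCommGroup H] [InnerProductSpace ℝ H] [CompleteSpace H]
  [RKHS ℝ H Y ℝ]

lemma rkhsKernel_eq_kerFun (y y' : Y) : rkhsKernel H y y' = RKHS.kerFun H y' 1 y :=
  (RKHS.kerFun_apply H y' 1 y).symm

lemma rkhsKernel_eq_inner (y y' : Y) :
    rkhsKernel H y y' = inner ℝ (RKHS.kerFun H y (1 : ℝ)) (RKHS.kerFun H y' (1 : ℝ)) := by
  rw [rkhsKernel_eq_kerFun, RKHS.kerFun_inner]
  simp

lemma rkhsKernel_comm (y y' : Y) : rkhsKernel H y y' = rkhsKernel H y' y := by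
  rw [rkhsKernel_eq_inner, rkhsKernel_eq_inner, real_inner_comm]

lemma posSemidef_gram_rkhsKernel {ι : Type*} [Fintype ι] (r : ι → Y) :
    (gram (rkhsKernel H) r r).PosSemidef := by
  have : gram (rkhsKernel H) r r = Matrix.gram ℝ fun i => RKHS.kerFun H (r i) (1 : ℝ) := by
    ext i j
    simp [gram, Matrix.gram, rkhsKernel_eq_inner]
  rw [this]
  exact Matrix.posSemidef_gram ..

/-- The prior kernel `r(y, y') = ∫ k(y, u) k(u, y') ν(du)` is positive semidefinite. -/
lemma posSemidef_gram_convKernel [MeasurableSpace Y] {ν : Measure Y}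
    (hν : ∀ y : Y, MemLp (fun u => rkhsKernel H y u) 2 ν) {ι : Type*} [Fintype ι] (r : ι → Y) :
    (gram (convKernel (rkhsKernel H) ν) r r).PosSemidef := by
  -- By symmetry of `k`, the value `r(y, y')` is the `L²(ν)` inner product of the sections at `y`
  -- and `y'`.
  have : gram (convKernel (rkhsKernel H) ν) r r = Matrix.gram ℝ fun i => (hν (r i)).toLp := by
    ext i j
    simp only [gram, convKernel, Matrix.gram, Matrix.of_apply, L2.inner_def]
    refine integral_congr_ae ?_
    filter_upwards [(hν (r i)).coeFn_toLp, (hν (r j)).coeFn_toLp] with u hi hj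
    rw [hi, hj, rkhsKernel_comm u]
    simp [mul_comm]
  rw [this]
  exact Matrix.posSemidef_gram ..

/-- The representer theorem for kernel ridge regression. -/
theorem IsKernelRidgeRegressor.eq_sum {ι : Type*} [Fintype ι] [DecidableEq ι] {lamF : ℝ}
    (hlamF : 0 < lamF) {r : ι → Y} {y : ι → ℝ} {f : H} (hf : IsKernelRidgeRegressor lamF r y f) :
    f = ∑ j, ((gram (rkhsKernel H) r r + lamF • (1 : Matrix ι ι ℝ))⁻¹ *ᵥ y) j •
      RKHS.kerFun H (r j) (1 : ℝ) := by
  -- Stationarity of the objective: along `f + t • h` its increment is a nonnegative quadratic in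
  -- `t` without constant term, so the discriminant bound forces the linear coefficient to vanish.
  have hstat : ∀ h : H, lamF * inner ℝ f h = ∑ j, (y j - f (r j)) * h (r j) := by
    intro h
    have key : ∀ t : ℝ, 0 ≤ (∑ j, h (r j) ^ 2 + lamF * ‖h‖ ^ 2) * (t * t) +
        (2 * (lamF * inner ℝ f h - ∑ j, (y j - f (r j)) * h (r j))) * t + 0 := by
      intro t
      have := hf (f + t • h)
      rw [norm_add_sq_real, inner_smul_right, norm_smul, mul_pow, Real.norm_eq_abs, sq_abs] at this
      have hs : ∑ j, (y j - (f + t • h) (r j)) ^ 2 = ∑ j, (y j - f (r j)) ^ 2 -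
          2 * t * ∑ j, (y j - f (r j)) * h (r j) + t ^ 2 * ∑ j, h (r j) ^ 2 := by
        rw [Finset.mul_sum, Finset.mul_sum, ← Finset.sum_sub_distrib, ← Finset.sum_add_distrib]
        refine Finset.sum_congr rfl fun j _ => ?_
        simp only [RKHS.coe_add, RKHS.coe_smul, Pi.add_apply, Pi.smul_apply, smul_eq_mul]
        ring
      rw [hs] at this
      linarith
    have := discrim_le_zero key
    simp only [discrim, mul_zero, sub_zero] at this
    have := pow_eq_zero_iff (two_ne_zero) |>.1 (le_antisymm this (sq_nonneg _))
    linarith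
  set c : ι → ℝ := fun j => lamF⁻¹ * (y j - f (r j)) with hc
  have hfc : f = ∑ j, c j • RKHS.kerFun H (r j) (1 : ℝ) := by
    refine ext_inner_right ℝ fun h => ?_
    simp only [sum_inner, inner_smul_left, RKHS.kerFun_inner, hc]
    refine mul_left_cancel₀ hlamF.ne' ((hstat h).trans ?_)
    rw [Finset.mul_sum]
    refine Finset.sum_congr rfl fun j _ => ?_
    simp
    field_simp
  have hdet : IsUnit (gram (rkhsKernel H) r r + lamF • (1 : Matrix ι ι ℝ)).det :=
    (Matrix.isUnit_iff_isUnit_det _).1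
      ((Matrix.PosDef.one.smul hlamF).posSemidef_add (posSemidef_gram_rkhsKernel r)).isUnit
  -- Evaluating the expansion of `f` at the data points gives the linear system that determines the
  -- coefficients.
  have hcy : (gram (rkhsKernel H) r r + lamF • (1 : Matrix ι ι ℝ)) *ᵥ c = y := by
    ext i
    have hfi : f (r i) = (gram (rkhsKernel H) r r *ᵥ c) i := by
      have : f (r i) = inner ℝ f (RKHS.kerFun H (r i) (1 : ℝ)) := by simp
      rw [this, hfc, sum_inner, Matrix.mulVec, dotProduct]
      refine Finset.sum_congr rfl fun j _ => ?_
      rw [inner_smul_left, ← rkhsKernel_eq_inner, rkhsKernel_comm]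
      simp [gram, mul_comm]
    rw [Matrix.add_mulVec, Pi.add_apply, ← hfi, Matrix.smul_mulVec, Matrix.one_mulVec]
    simp only [hc, Pi.smul_apply, smul_eq_mul]
    field_simp
    ring
  rw [← hcy, Matrix.mulVec_mulVec, Matrix.nonsing_inv_mul _ hdet, Matrix.one_mulVec]
  exact hfc

end RKHS

/-! ### Full support and conditioning of Gaussian vectors -/

section Gaussian

variable {Ω : Type*} [MeasurableSpace Ω] {P : Measure Ω}

lemma isOpenPosMeasure_gaussianReal (μ : ℝ) {v : NNReal} (hv : v ≠ 0) :
    (gaussianReal μ v).IsOpenPosMeasure :=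
  (gaussianReal_absolutelyContinuous' μ hv).isOpenPosMeasure

/-- A Gaussian vector with positive definite covariance matrix charges every nonempty open set. -/
theorem isOpenPosMeasure_map_of_posDef {ι : Type*} [Fintype ι] [DecidableEq ι] {Z : ι → Ω → ℝ}
    (hZ : HasGaussianLaw (fun ω i => Z i ω) P) {S : Matrix ι ι ℝ} (hS : S.PosDef)
    (hcov : ∀ i j, cov[Z i, Z j; P] = S i j) :
    (P.map fun ω i => Z i ω).IsOpenPosMeasure := by
  have := hZ.isProbabilityMeasure
  obtain ⟨y, hy⟩ : ∃ y : Matrix ι ι ℝ, S = yᵀ * y := by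
    open scoped MatrixOrder in
    obtain ⟨y, hy⟩ := CStarAlgebra.nonneg_iff_eq_star_mul_self.mp hS.posSemidef.nonneg
    exact ⟨y, by rw [hy, Matrix.star_eq_conjTranspose, Matrix.conjTranspose_eq_transpose_of_trivial]⟩
  have hydet : IsUnit y.det := by
    have := (Matrix.isUnit_iff_isUnit_det _).1 hS.isUnit
    rw [hy, Matrix.det_mul] at this
    exact isUnit_of_mul_isUnit_right this
  -- Whitening: since `S = yᵀ * y`, the vector `T Z` has identity covariance. Its law is thus a
  -- product of nondegenerate normal laws, and `yᵀ` carries it back to that of `Z`.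
  set T : Matrix ι ι ℝ := (y⁻¹)ᵀ with hT
  have hW : HasGaussianLaw (fun ω i => (T *ᵥ fun j => Z j ω) i) P :=
    hZ.map_fun (Matrix.toLin' T).toContinuousLinearMap
  have hWcov : ∀ i k, cov[fun ω => (T *ᵥ fun j => Z j ω) i, fun ω => (T *ᵥ fun j => Z j ω) k; P] =
      (1 : Matrix ι ι ℝ) i k := by
    intro i k
    have h1 : T * S * Tᵀ = 1 := by
      rw [hy, hT, Matrix.transpose_transpose, Matrix.mul_assoc, Matrix.mul_assoc,
        Matrix.mul_nonsing_inv _ hydet, Matrix.mul_one, ← Matrix.transpose_mul,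
        Matrix.mul_nonsing_inv _ hydet, Matrix.transpose_one]
    simp only [Matrix.mulVec, dotProduct]
    rw [covariance_fun_sum_fun_sum (fun j => (hZ.eval j).memLp_two.const_mul _)
      (fun j => (hZ.eval j).memLp_two.const_mul _), ← h1, Matrix.mul_apply, Finset.sum_comm]
    refine Finset.sum_congr rfl fun l _ => ?_
    rw [Matrix.mul_apply, Finset.sum_mul]
    refine Finset.sum_congr rfl fun j _ => ?_
    rw [covariance_const_mul_left, covariance_const_mul_right, hcov, Matrix.transpose_apply]
    ring
  have hWind := hW.iIndepFun_of_covariance_eq_zero fun i k hik => by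
    rw [hWcov, Matrix.one_apply_ne hik]
  have hpi := (iIndepFun_iff_map_fun_eq_pi_map fun i => (hW.eval i).aemeasurable).1 hWind
  have hpos : (P.map fun ω i => (T *ᵥ fun j => Z j ω) i).IsOpenPosMeasure := by
    have (i : ι) : (P.map fun ω => (T *ᵥ fun j => Z j ω) i).IsOpenPosMeasure := by
      rw [(hW.eval i).map_eq_gaussianReal]
      refine isOpenPosMeasure_gaussianReal _ ?_
      rw [← covariance_self (hW.eval i).aemeasurable, hWcov]
      simp
    have (i : ι) : IsProbabilityMeasure (P.map fun ω => (T *ᵥ fun j => Z j ω) i) :=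
      Measure.isProbabilityMeasure_map (hW.eval i).aemeasurable
    rw [hpi]
    infer_instance
  have hZW : (P.map fun ω i => Z i ω) =
      (P.map fun ω i => (T *ᵥ fun j => Z j ω) i).map (fun w => yᵀ *ᵥ w) := by
    rw [AEMeasurable.map_map_of_aemeasurable (by fun_prop) hW.aemeasurable]
    congr 1
    ext1 ω
    change _ = yᵀ *ᵥ (T *ᵥ _)
    rw [Matrix.mulVec_mulVec, hT, ← Matrix.transpose_mul, Matrix.nonsing_inv_mul _ hydet,
      Matrix.transpose_one, Matrix.one_mulVec]
  rw [hZW]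
  refine Continuous.isOpenPosMeasure_map (by fun_prop) fun z => ⟨(y⁻¹)ᵀ *ᵥ z, ?_⟩
  change yᵀ *ᵥ ((y⁻¹)ᵀ *ᵥ z) = z
  rw [Matrix.mulVec_mulVec, ← Matrix.transpose_mul, Matrix.nonsing_inv_mul _ hydet,
    Matrix.transpose_one, Matrix.one_mulVec]

/-- The normal equations of the regression: a Kronecker product acts on a product vector factor by
factor, so `Q ⊗ R` sends `Q⁻¹a ⊗ R⁻¹b` to `a ⊗ b`. -/
lemma sum_sum_mul_mulVec_inv {n m : Type*} [Fintype n] [DecidableEq n] [Fintype m] [DecidableEq m]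
    {Q : Matrix n n ℝ} {R : Matrix m m ℝ} (hQ : Q.PosDef) (hR : R.PosDef) (a : n → ℝ) (b : m → ℝ)
    (i : n) (j : m) :
    ∑ k, ∑ l, (Q⁻¹ *ᵥ a) k * (R⁻¹ *ᵥ b) l * (Q i k * R j l) = a i * b j := by
  have hQd := (Matrix.isUnit_iff_isUnit_det _).1 hQ.isUnit
  have hRd := (Matrix.isUnit_iff_isUnit_det _).1 hR.isUnit
  have ha : (Q *ᵥ (Q⁻¹ *ᵥ a)) i = a i := by
    rw [Matrix.mulVec_mulVec, Matrix.mul_nonsing_inv _ hQd, Matrix.one_mulVec]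
  have hb : (R *ᵥ (R⁻¹ *ᵥ b)) j = b j := by
    rw [Matrix.mulVec_mulVec, Matrix.mul_nonsing_inv _ hRd, Matrix.one_mulVec]
  rw [← ha, ← hb, Matrix.mulVec, Matrix.mulVec, dotProduct, dotProduct, Finset.sum_mul_sum]
  refine Finset.sum_congr rfl fun k _ => Finset.sum_congr rfl fun l _ => ?_
  ring

/-- Gaussian conditioning for a matrix of observations whose covariance is a Kronecker product. -/
theorem exists_hasPosterior_of_hasGaussianLaw {n m : Type*} [Fintype n] [DecidableEq n] [Fintype m]
    [DecidableEq m] {Z : n → m → Ω → ℝ} {η : Ω → ℝ}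
    (hG : HasGaussianLaw (fun ω => ((fun i j => Z i j ω : n → m → ℝ), η ω)) P)
    (hZ0 : ∀ i j, ∫ ω, Z i j ω ∂P = 0) (hη0 : ∫ ω, η ω ∂P = 0)
    {Q : Matrix n n ℝ} {R : Matrix m m ℝ} (hQ : Q.PosDef) (hR : R.PosDef)
    (hcov : ∀ i j k l, cov[Z i j, Z k l; P] = Q i k * R j l) {a : n → ℝ} {b : m → ℝ}
    (hcross : ∀ i j, cov[Z i j, η; P] = a i * b j) (z : n → m → ℝ) :
    ∃ hσ : 0 ≤ cov[η, η; P] - (a ⬝ᵥ (Q⁻¹ *ᵥ a)) * (b ⬝ᵥ (R⁻¹ *ᵥ b)),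
      HasPosterior P (fun ω i j => Z i j ω) η z
        (gaussianReal (∑ i, ∑ j, (Q⁻¹ *ᵥ a) i * (R⁻¹ *ᵥ b) j * z i j) ⟨_, hσ⟩) := by
  have := hG.isProbabilityMeasure
  set w : n → m → ℝ := fun i j => (Q⁻¹ *ᵥ a) i * (R⁻¹ *ᵥ b) j with hw
  let g : (n → m → ℝ) →L[ℝ] ℝ := ∑ i, ∑ j, w i j •
    ((ContinuousLinearMap.proj (R := ℝ) (φ := fun _ : m => ℝ) j).comp
      (ContinuousLinearMap.proj (R := ℝ) (φ := fun _ : n => m → ℝ) i))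
  have hg : ∀ u, g u = ∑ i, ∑ j, w i j * u i j := by
    intro u
    simp [g]
  have hZG : ∀ i j, HasGaussianLaw (Z i j) P := fun i j => (hG.fst.eval i).eval j
  have hZ2 : ∀ i j, MemLp (Z i j) 2 P := fun i j => (hZG i j).memLp_two
  have hη2 : MemLp η 2 P := hG.snd.memLp_two
  -- The residual of the linear regression of `η` on the observations.
  set ξ : Ω → ℝ := fun ω => η ω - g (fun i j => Z i j ω) with hξ
  have hgcov : ∀ X : Ω → ℝ, MemLp X 2 P → cov[X, fun ω => g (fun i j => Z i j ω); P] =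
      ∑ i, ∑ j, w i j * cov[X, Z i j; P] := by
    intro X hX
    simp only [hg]
    rw [covariance_fun_sum_right
      (fun i => memLp_finsetSum _ fun j _ => (hZ2 i j).const_mul _) hX]
    refine Finset.sum_congr rfl fun i _ => ?_
    rw [covariance_fun_sum_right (fun j => (hZ2 i j).const_mul _) hX]
    exact Finset.sum_congr rfl fun j _ => covariance_const_mul_right _
  have hg2 : MemLp (fun ω => g (fun i j => Z i j ω)) 2 P := (hG.fst.map_fun g).memLp_two
  have hZξ : ∀ i j, cov[Z i j, ξ; P] = 0 := by
    intro i j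
    rw [hξ, covariance_fun_sub_right (hZ2 i j) hη2 hg2, hgcov _ (hZ2 i j), hcross]
    simp only [hcov, hw]
    rw [sum_sum_mul_mulVec_inv hQ hR, sub_self]
  have hξ2 : MemLp ξ 2 P := hη2.sub hg2
  -- Pythagoras: `ξ` is orthogonal to the fitted part, so its variance is `Var η` minus the
  -- covariance of `η` with that part.
  have hvar : cov[ξ, ξ; P] = cov[η, η; P] - (a ⬝ᵥ (Q⁻¹ *ᵥ a)) * (b ⬝ᵥ (R⁻¹ *ᵥ b)) := by
    have h1 : cov[ξ, fun ω => g (fun i j => Z i j ω); P] = 0 := by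
      rw [hgcov _ hξ2]
      refine Finset.sum_eq_zero fun i _ => Finset.sum_eq_zero fun j _ => ?_
      rw [covariance_comm, hZξ, mul_zero]
    have h2 : cov[ξ, ξ; P] = cov[ξ, η; P] := by
      conv_lhs => rw [hξ]
      rw [covariance_fun_sub_right hξ2 hη2 hg2, h1, sub_zero]
    rw [h2, covariance_comm, hξ, covariance_fun_sub_right hη2 hη2 hg2, hgcov _ hη2,
      dotProduct, dotProduct, Finset.sum_mul_sum]
    congr 1
    refine Finset.sum_congr rfl fun i _ => Finset.sum_congr rfl fun j _ => ?_
    rw [covariance_comm, hcross, hw]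
    ring
  have hσ : 0 ≤ cov[η, η; P] - (a ⬝ᵥ (Q⁻¹ *ᵥ a)) * (b ⬝ᵥ (R⁻¹ *ᵥ b)) := by
    rw [← hvar, covariance_self hξ2.aemeasurable]
    exact variance_nonneg _ _
  refine ⟨hσ, ?_⟩
  -- Flattens the array to the index `n × m` and makes the residual a family over `Unit`, the form
  -- needed by the criterion that jointly Gaussian uncorrelated families are independent.
  let Φ : ((n → m → ℝ) × ℝ) →L[ℝ] ((n × m → ℝ) × (Unit → ℝ)) :=
    { toFun := fun p => (fun q => p.1 q.1 q.2, fun _ => p.2 - g p.1)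
      map_add' := fun p q => by
        ext
        · simp
        · simp only [Prod.fst_add, Prod.snd_add, map_add, Pi.add_apply]; ring
      map_smul' := fun c p => by
        ext
        · simp
        · simp [mul_sub]
      cont := by fun_prop }
  have hΦ : HasGaussianLaw (fun ω => (fun q : n × m => Z q.1 q.2 ω, fun _ : Unit => ξ ω)) P :=
    hG.map_fun Φ
  have hind := hΦ.indepFun_of_covariance_eval (X := fun q : n × m => Z q.1 q.2)
    (Y := fun _ : Unit => ξ) fun q _ => hZξ q.1 q.2
  have hind' : IndepFun (fun ω i j => Z i j ω) ξ P :=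
    hind.comp (φ := fun (u : n × m → ℝ) (i : n) (j : m) => u (i, j)) (ψ := fun u : Unit → ℝ => u ())
      (by fun_prop) (by fun_prop)
  have hpos : (P.map fun ω i j => Z i j ω).IsOpenPosMeasure := by
    have h := isOpenPosMeasure_map_of_posDef (Z := fun q : n × m => Z q.1 q.2) hΦ.fst
      (hQ.kronecker hR) (fun p q => hcov p.1 p.2 q.1 q.2)
    have hmap : (P.map fun ω i j => Z i j ω) = (P.map fun ω (q : n × m) => Z q.1 q.2 ω).map
        (fun (u : n × m → ℝ) (i : n) (j : m) => u (i, j)) := by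
      have hm : Measurable (fun (u : n × m → ℝ) (i : n) (j : m) => u (i, j)) := by fun_prop
      rw [AEMeasurable.map_map_of_aemeasurable hm.aemeasurable hΦ.fst.aemeasurable]
      rfl
    rw [hmap]
    exact Continuous.isOpenPosMeasure_map (by fun_prop) fun u => ⟨fun q => u q.1 q.2, rfl⟩
  have hξG : HasGaussianLaw ξ P := hΦ.snd.eval ()
  have hξ0 : ∫ ω, ξ ω ∂P = 0 := by
    rw [hξ, integral_sub (hη2.integrable one_le_two) (hg2.integrable one_le_two), hη0]
    simp only [hg]
    rw [integral_finsetSum _ fun i _ => integrable_finsetSum _ fun j _ =>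
      ((hZ2 i j).integrable one_le_two).const_mul _]
    rw [zero_sub, neg_eq_zero]
    refine Finset.sum_eq_zero fun i _ => ?_
    rw [integral_finsetSum _ fun j _ => ((hZ2 i j).integrable one_le_two).const_mul _]
    refine Finset.sum_eq_zero fun j _ => ?_
    rw [integral_const_mul, hZ0, mul_zero]
  have hpost := hasPosterior_of_indepFun (Z := fun ω i j => Z i j ω) (η := η) (ξ := ξ) (m := g)
    (v := ⟨_, hσ⟩) hG.fst.aemeasurable g.continuous hpos hξG.aemeasurable
    (by
      rw [hξG.map_eq_gaussianReal, hξ0, ← covariance_self hξG.aemeasurable, hvar]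
      congr 1
      exact Real.toNNReal_of_nonneg hσ)
    hind' (fun ω => by simp [hξ]) z
  rw [hg] at hpost
  exact hpost

end Gaussian

/-- The points `p i` may repeat: the process is reindexed by `ι` before its full finite marginal is
taken. -/
lemma hasGaussianLaw_comp_of_finite {Ω T ι : Type*} [MeasurableSpace Ω] {P : Measure Ω}
    [Finite ι] {X : T → Ω → ℝ} (hX : IsGaussianProcess X P) (p : ι → T) :
    HasGaussianLaw (fun ω i => X (p i) ω) P := by
  have := Fintype.ofFinite ι
  let K : (↥(Finset.univ : Finset ι) → ℝ) →L[ℝ] ι → ℝ :=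
    { toFun x i := x ⟨i, Finset.mem_univ i⟩
      map_add' x y := rfl
      map_smul' c x := rfl }
  exact ((hX.comp_right p).hasGaussianLaw Finset.univ).map_fun K

/-- The Schur product theorem, as the Gram matrix is the entrywise product of those of `ku` and
`ka`. -/
lemma gram_prodKernel_posSemidef {U A ι : Type*} {ku : U → U → ℝ}
    (hku : (Matrix.of ku).PosSemidef) {ka : A → A → ℝ} (hka : (Matrix.of ka).PosSemidef)
    (x : ι → U × A) : (gram (prodKernel ku ka) x x).PosSemidef :=
  (hku.submatrix fun i => (x i).1).hadamard (hka.submatrix fun i => (x i).2)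

/-! ### Second moments and joint Gaussianity in the model -/

section Model

variable {Ω X Y H : Type*} [MeasurableSpace Ω] [NormedAddCommGroup H] [InnerProductSpace ℝ H]
  [RKHS ℝ H Y ℝ] {N : ℕ} {P : Measure Ω} {kx : X → X → ℝ} {ry : Y → Y → ℝ} {emb : X → Ω → H}
  {noise : Fin N → Y → Ω → ℝ}

lemma IsCenteredGP.memLp {T : Type*} {Z : T → Ω → ℝ} {c : T → T → ℝ} (h : IsCenteredGP P Z c)
    (t : T) : MemLp (Z t) 2 P :=
  (h.gaussian.hasGaussianLaw_eval t).memLp_two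

namespace IsBayesCMEModel

variable (h : IsBayesCMEModel P kx ry emb noise)
include h

lemma memLp_emb (x : X) (y : Y) : MemLp (fun ω => emb x ω y) 2 P := h.prior.memLp (x, y)

lemma cov_emb (x x' : X) (y y' : Y) :
    cov[fun ω => emb x ω y, fun ω => emb x' ω y'; P] = kx x x' * ry y y' :=
  h.prior.cov_eq (x, y) (x', y')

lemma cov_emb_noise (x : X) (y y' : Y) (i : Fin N) :
    cov[fun ω => emb x ω y, noise i y'; P] = 0 := by
  have hi : IndepFun (fun ω => emb x ω y) (noise i y') P :=
    h.prior_indep_noise.comp (φ := fun u : X × Y → ℝ => u (x, y))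
      (ψ := fun u : Fin N × Y → ℝ => u (i, y')) (by fun_prop) (by fun_prop)
  exact hi.covariance_eq_zero (h.memLp_emb x y) ((h.noise_gp i).memLp y')

lemma cov_noise (i k : Fin N) (y y' : Y) :
    cov[noise i y, noise k y'; P] = (1 : Matrix (Fin N) (Fin N) ℝ) i k * ry y y' := by
  rcases eq_or_ne i k with rfl | hik
  · rw [(h.noise_gp i).cov_eq, Matrix.one_apply_eq, one_mul]
  · have hi : IndepFun (noise i y) (noise k y') P :=
      (h.noise_indep.indepFun hik).comp (φ := fun u : Y → ℝ => u y) (ψ := fun u : Y → ℝ => u y')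
        (by fun_prop) (by fun_prop)
    rw [hi.covariance_eq_zero ((h.noise_gp i).memLp y) ((h.noise_gp k).memLp y'),
      Matrix.one_apply_ne hik, zero_mul]

/-- Cross terms vanish by independence. Prior and noise share the factor `ry`, so `kx` and `lam`
times the identity add up in the other factor. -/
lemma cov_observation [IsProbabilityMeasure P] {lam : ℝ} (hlam : 0 ≤ lam) (x : Fin N → X)
    (r : Fin N → Y) (i j k l : Fin N) :
    cov[fun ω => observation lam emb noise x r ω i j,
      fun ω => observation lam emb noise x r ω k l; P] =
      (gram kx x x + lam • (1 : Matrix (Fin N) (Fin N) ℝ)) i k * gram ry r r j l := by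
  have he := fun i j => h.memLp_emb (x i) (r j)
  have hn := fun i j => ((h.noise_gp i).memLp (r j)).const_mul √lam
  change cov[(fun ω => emb (x i) ω (r j)) + fun ω => √lam * noise i (r j) ω,
    (fun ω => emb (x k) ω (r l)) + fun ω => √lam * noise k (r l) ω; P] = _
  rw [covariance_add_left (he i j) (hn i j) ((he k l).add (hn k l)),
    covariance_add_right (he i j) (he k l) (hn k l), covariance_add_right (hn i j) (he k l) (hn k l),
    covariance_const_mul_left, covariance_const_mul_left, covariance_const_mul_right,
    covariance_const_mul_right, covariance_comm (noise i (r j)), h.cov_emb, h.cov_emb_noise,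
    h.cov_emb_noise, h.cov_noise, ← mul_assoc √lam, Real.mul_self_sqrt hlam]
  simp only [gram, Matrix.add_apply, Matrix.smul_apply, Matrix.of_apply, smul_eq_mul]
  ring

lemma cov_observation_emb [IsProbabilityMeasure P] (lam : ℝ) (x : Fin N → X)
    (r : Fin N → Y) (i j : Fin N) (x' : X) (y' : Y) :
    cov[fun ω => observation lam emb noise x r ω i j, fun ω => emb x' ω y'; P] =
      kx (x i) x' * ry (r j) y' := by
  change cov[(fun ω => emb (x i) ω (r j)) + fun ω => √lam * noise i (r j) ω, _; P] = _
  rw [covariance_add_left (h.memLp_emb _ _) (((h.noise_gp i).memLp (r j)).const_mul √lam)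
    (h.memLp_emb _ _), covariance_const_mul_left, covariance_comm (noise i (r j)), h.cov_emb,
    h.cov_emb_noise, mul_zero, add_zero]

lemma integral_observation [IsProbabilityMeasure P] (lam : ℝ) (x : Fin N → X)
    (r : Fin N → Y) (i j : Fin N) :
    ∫ ω, observation lam emb noise x r ω i j ∂P = 0 := by
  simp only [observation]
  rw [integral_add ((h.memLp_emb _ _).integrable one_le_two)
    ((((h.noise_gp i).memLp (r j)).integrable one_le_two).const_mul _), integral_const_mul,
    h.prior.mean_eq_zero (x i, r j), (h.noise_gp i).mean_eq_zero]
  simp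

/-- The observations and a linear functional of the embedding are jointly Gaussian. -/
lemma hasGaussianLaw_observation_prodMk {ι κ : Type*} [Fintype ι] [Fintype κ] (lam : ℝ)
    (x : Fin N → X) (r : Fin N → Y) (x' : ι → X) (r' : κ → Y) (c : ι → κ → ℝ) :
    HasGaussianLaw (fun ω => ((fun i j => observation lam emb noise x r ω i j : Fin N → Fin N → ℝ),
      ∑ l, ∑ m, c l m * emb (x' l) ω (r' m))) P := by
  -- Field values entering the observations and those entering the functional are gathered in one
  -- Gaussian vector, independent of the noise vector; everything is then a linear image of the
  -- pair.
  let p : (Fin N × Fin N) ⊕ (ι × κ) → X × Y :=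
    Sum.elim (fun q => (x q.1, r q.2)) (fun q => (x' q.1, r' q.2))
  have hV := hasGaussianLaw_comp_of_finite h.prior.gaussian p
  have hWi : ∀ i, HasGaussianLaw (fun ω j => noise i (r j) ω) P := fun i =>
    hasGaussianLaw_comp_of_finite (h.noise_gp i).gaussian r
  have hW : HasGaussianLaw (fun ω i j => noise i (r j) ω) P :=
    iIndepFun.hasGaussianLaw (X := fun (i : Fin N) ω (j : Fin N) => noise i (r j) ω) hWi
      (h.noise_indep.comp (fun _ (u : Y → ℝ) (j : Fin N) => u (r j)) fun _ => by fun_prop)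
  have hVW : IndepFun (fun ω s => emb (p s).1 ω (p s).2) (fun ω i j => noise i (r j) ω) P :=
    h.prior_indep_noise.comp (φ := fun (u : X × Y → ℝ) s => u (p s))
      (ψ := fun (u : Fin N × Y → ℝ) (i j : Fin N) => u (i, r j)) (by fun_prop) (by fun_prop)
  have hJ := hVW.hasGaussianLaw hV hW
  let Φ : (((Fin N × Fin N) ⊕ (ι × κ) → ℝ) × (Fin N → Fin N → ℝ)) →L[ℝ]
      ((Fin N → Fin N → ℝ) × ℝ) :=
    { toFun := fun u => (fun i j => u.1 (.inl (i, j)) + √lam * u.2 i j,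
        ∑ l, ∑ m, c l m * u.1 (.inr (l, m)))
      map_add' := fun u v => by
        ext
        · simp only [Prod.fst_add, Prod.snd_add, Pi.add_apply]; ring
        · simp [mul_add, Finset.sum_add_distrib]
      map_smul' := fun t u => by
        ext
        · simp only [Prod.smul_fst, Prod.smul_snd, Pi.smul_apply, smul_eq_mul, RingHom.id_apply]
          ring
        · simp [Finset.mul_sum, mul_left_comm]
      cont := by fun_prop }
  exact hJ.map_fun Φ

lemma cov_sum_right {ι κ : Type*} [Fintype ι] [Fintype κ] [IsProbabilityMeasure P] {Z : Ω → ℝ}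
    (hZ : MemLp Z 2 P) (x' : ι → X) (r' : κ → Y) (c : ι → κ → ℝ) :
    cov[Z, fun ω => ∑ l, ∑ m, c l m * emb (x' l) ω (r' m); P] =
      ∑ l, ∑ m, c l m * cov[Z, fun ω => emb (x' l) ω (r' m); P] := by
  rw [covariance_fun_sum_right
    (fun l => memLp_finsetSum _ fun m _ => (h.memLp_emb _ _).const_mul _) hZ]
  refine Finset.sum_congr rfl fun l _ => ?_
  rw [covariance_fun_sum_right (fun m => (h.memLp_emb _ _).const_mul _) hZ]
  exact Finset.sum_congr rfl fun m _ => covariance_const_mul_right _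

lemma integral_sum {ι κ : Type*} [Fintype ι] [Fintype κ] [IsProbabilityMeasure P]
    (x' : ι → X) (r' : κ → Y) (c : ι → κ → ℝ) :
    ∫ ω, ∑ l, ∑ m, c l m * emb (x' l) ω (r' m) ∂P = 0 := by
  have hi := fun l m => ((h.memLp_emb (x' l) (r' m)).integrable one_le_two).const_mul (c l m)
  rw [integral_finsetSum _ fun l _ => integrable_finsetSum _ fun m _ => hi l m]
  refine Finset.sum_eq_zero fun l _ => ?_
  rw [integral_finsetSum _ fun m _ => hi l m]
  refine Finset.sum_eq_zero fun m _ => ?_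
  rw [integral_const_mul, h.prior.mean_eq_zero (x' l, r' m), mul_zero]

end IsBayesCMEModel

end Model

/-! ### Transposes and symmetry of the kernels -/

lemma dotProduct_transpose_mulVec {n m : Type*} [Fintype n] [Fintype m] (M : Matrix n m ℝ)
    (u : m → ℝ) (v : n → ℝ) : u ⬝ᵥ (Mᵀ *ᵥ v) = (M *ᵥ u) ⬝ᵥ v := by
  rw [Matrix.dotProduct_mulVec, Matrix.vecMul_transpose]

lemma gram_transpose {X ι κ : Type*} {k : X → X → ℝ} (hk : ∀ s t, k s t = k t s) (s : ι → X)
    (t : κ → X) : (gram k s t)ᵀ = gram k t s := by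
  ext i j
  exact hk _ _

lemma convKernel_comm {Y : Type*} [MeasurableSpace Y] {k : Y → Y → ℝ}
    (hk : ∀ s t, k s t = k t s) (ν : Measure Y) (y y' : Y) :
    convKernel k ν y y' = convKernel k ν y' y := by
  refine integral_congr_ae (.of_forall fun u => ?_)
  simp only [hk y u, hk u y', mul_comm]

lemma prodKernel_comm {U A : Type*} {ku : U → U → ℝ}
    (hku : (Matrix.of ku).PosSemidef) {ka : A → A → ℝ} (hka : (Matrix.of ka).PosSemidef)
    (x x' : U × A) : prodKernel ku ka x x' = prodKernel ku ka x' x := by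
  have h1 := hku.isHermitian.apply x.1 x'.1
  have h2 := hka.isHermitian.apply x.2 x'.2
  simp only [Matrix.of_apply, star_trivial] at h1 h2
  rw [prodKernel, prodKernel, h1, h2]

end BayesRCFME

/-! ### The posterior of the counterfactual functional -/

theorem mainTheorem3 {U A Y Ω H : Type*}
    -- the RKHS `H` of the reward kernel `k`, and the kernels on contexts and on actions
    [MeasurableSpace Y] [NormedAddCommGroup H] [InnerProductSpace ℝ H] [CompleteSpace H]
    [RKHS ℝ H Y ℝ]
    (ku : U → U → ℝ) (hku : (Matrix.of ku).PosSemidef)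
    (ka : A → A → ℝ) (hka : (Matrix.of ka).PosSemidef)
    -- the finite measure that defines the prior kernel on rewards (the integrals converge)
    (ν : Measure Y) [IsFiniteMeasure ν]
    (hν : ∀ y : Y, MemLp (fun u => BayesRCFME.rkhsKernel H y u) 2 ν)
    -- the data sets
    (N M L : ℕ) (hL : 0 < L)
    (x : Fin N → U × A) (r : Fin N → Y)
    (r' : Fin M → Y) (y : Fin M → ℝ)
    (x' : Fin L → U × A)
    -- the inverse of the Gram matrix of the prior kernel exists
    (hR : IsUnit (BayesRCFME.gram
      (BayesRCFME.convKernel (BayesRCFME.rkhsKernel H) ν) r r).det)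
    (lam lamF : ℝ) (hlam : 0 < lam) (hlamF : 0 < lamF)
    -- the kernel ridge regressor
    (f : H) (hf : BayesRCFME.IsKernelRidgeRegressor lamF r' y f)
    -- the Bayesian model
    [MeasurableSpace Ω] (P : Measure Ω) [IsProbabilityMeasure P]
    (emb : U × A → Ω → H) (noise : Fin N → Y → Ω → ℝ)
    (hmodel : BayesRCFME.IsBayesCMEModel P (BayesRCFME.prodKernel ku ka)
      (BayesRCFME.convKernel (BayesRCFME.rkhsKernel H) ν) emb noise) :
    let kx := BayesRCFME.prodKernel ku ka
    let k := BayesRCFME.rkhsKernel H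
    let ry := BayesRCFME.convKernel k ν
    let Kxx : Matrix (Fin N) (Fin N) ℝ := BayesRCFME.gram kx x x
    let Kx'x : Matrix (Fin L) (Fin N) ℝ := BayesRCFME.gram kx x' x
    let Kxx' : Matrix (Fin N) (Fin L) ℝ := BayesRCFME.gram kx x x'
    let Kx'x' : Matrix (Fin L) (Fin L) ℝ := BayesRCFME.gram kx x' x'
    let Krr : Matrix (Fin N) (Fin N) ℝ := BayesRCFME.gram k r r
    let Kr'r' : Matrix (Fin M) (Fin M) ℝ := BayesRCFME.gram k r' r'
    let Rrr : Matrix (Fin N) (Fin N) ℝ := BayesRCFME.gram ry r r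
    let Rrr' : Matrix (Fin N) (Fin M) ℝ := BayesRCFME.gram ry r r'
    let Rr'r : Matrix (Fin M) (Fin N) ℝ := BayesRCFME.gram ry r' r
    let Rr'r' : Matrix (Fin M) (Fin M) ℝ := BayesRCFME.gram ry r' r'
    let one : Fin L → ℝ := fun _ => 1
    let α : Fin M → ℝ := (Kr'r' + lamF • (1 : Matrix (Fin M) (Fin M) ℝ))⁻¹ *ᵥ y
    let B : ℝ := α ⬝ᵥ (Rr'r' *ᵥ α)
    let C : ℝ := α ⬝ᵥ ((Rr'r * Rrr⁻¹ * Rrr') *ᵥ α)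
    let μ₂ : ℝ := 1 / (L : ℝ) * (one ⬝ᵥ
      ((Kx'x * (Kxx + lam • (1 : Matrix (Fin N) (Fin N) ℝ))⁻¹ * Krr * Rrr⁻¹ * Rrr') *ᵥ α))
    let σ₂sq : ℝ := B * (1 / (L : ℝ) ^ 2 * (one ⬝ᵥ (Kx'x' *ᵥ one))) -
      C * (1 / (L : ℝ) ^ 2 * (one ⬝ᵥ
        ((Kx'x * (Kxx + lam • (1 : Matrix (Fin N) (Fin N) ℝ))⁻¹ * Kxx') *ᵥ one)))
    ∃ hσ : 0 ≤ σ₂sq,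
      BayesRCFME.HasPosterior P (BayesRCFME.observation lam emb noise x r)
        (fun ω => inner ℝ f (BayesRCFME.counterfactualEmbedding emb x' ω))
        (fun i j => k (r i) (r j))
        (gaussianReal μ₂ ⟨σ₂sq, hσ⟩) := by
  intro kx k ry Kxx Kx'x Kxx' Kx'x' Krr Kr'r' Rrr Rrr' Rr'r Rr'r' one α B C μ₂ σ₂sq
  have hkx : ∀ s t, kx s t = kx t s := BayesRCFME.prodKernel_comm hku hka
  have hry : ∀ s t, ry s t = ry t s :=
    BayesRCFME.convKernel_comm BayesRCFME.rkhsKernel_comm ν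
  set Q : Matrix (Fin N) (Fin N) ℝ := Kxx + lam • (1 : Matrix (Fin N) (Fin N) ℝ) with hQdef
  have hQ : Q.PosDef :=
    (Matrix.PosDef.one.smul hlam).posSemidef_add
      (BayesRCFME.gram_prodKernel_posSemidef hku hka x)
  have hRrr : Rrr.PosDef :=
    (BayesRCFME.posSemidef_gram_convKernel hν r).posDef_iff_isUnit.2
      ((Matrix.isUnit_iff_isUnit_det _).2 hR)
  have hQt : (Q⁻¹)ᵀ = Q⁻¹ := hQ.inv.isHermitian
  -- The two factors of the covariance between the observations and `η`.
  set a : Fin N → ℝ := (1 / (L : ℝ)) • (Kxx' *ᵥ one) with ha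
  set b : Fin N → ℝ := Rrr' *ᵥ α with hb
  have hη : (fun ω => inner ℝ f (BayesRCFME.counterfactualEmbedding emb x' ω)) =
      fun ω => ∑ l, ∑ m, (1 / (L : ℝ) * α m) * emb (x' l) ω (r' m) := by
    funext ω
    rw [hf.eq_sum hlamF, BayesRCFME.counterfactualEmbedding, inner_smul_right, inner_sum,
      Finset.mul_sum]
    refine Finset.sum_congr rfl fun l _ => ?_
    rw [sum_inner, Finset.mul_sum]
    refine Finset.sum_congr rfl fun m _ => ?_
    rw [inner_smul_left, RKHS.kerFun_inner, mul_assoc]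
    simp [α, Kr'r', k]
  have hcross : ∀ i j, cov[fun ω => BayesRCFME.observation lam emb noise x r ω i j,
      fun ω => ∑ l, ∑ m, (1 / (L : ℝ) * α m) * emb (x' l) ω (r' m); P] = a i * b j := by
    intro i j
    have hG := (hmodel.hasGaussianLaw_observation_prodMk lam x r x' r'
      (fun _ m => 1 / (L : ℝ) * α m)).fst
    rw [hmodel.cov_sum_right ((hG.eval i).eval j).memLp_two]
    have hai : a i = ∑ l, 1 / (L : ℝ) * kx (x i) (x' l) := by
      simp [ha, Matrix.mulVec, dotProduct, one, Kxx', BayesRCFME.gram, Finset.mul_sum]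
    have hbj : b j = ∑ m, ry (r j) (r' m) * α m := rfl
    rw [hai, hbj, Finset.sum_mul_sum]
    refine Finset.sum_congr rfl fun l _ => Finset.sum_congr rfl fun m _ => ?_
    rw [hmodel.cov_observation_emb]
    ring
  have hvar : cov[fun ω => ∑ l, ∑ m, (1 / (L : ℝ) * α m) * emb (x' l) ω (r' m),
      fun ω => ∑ l, ∑ m, (1 / (L : ℝ) * α m) * emb (x' l) ω (r' m); P] =
      B * (1 / (L : ℝ) ^ 2 * (one ⬝ᵥ (Kx'x' *ᵥ one))) := by
    have hG := (hmodel.hasGaussianLaw_observation_prodMk lam x r x' r'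
      (fun _ m => 1 / (L : ℝ) * α m)).snd
    rw [hmodel.cov_sum_right hG.memLp_two]
    have hc : ∀ l m, cov[fun ω => ∑ l, ∑ m, (1 / (L : ℝ) * α m) * emb (x' l) ω (r' m),
        fun ω => emb (x' l) ω (r' m); P] =
        1 / (L : ℝ) * (Kx'x' *ᵥ one) l * (Rr'r' *ᵥ α) m := by
      intro l m
      rw [covariance_comm, hmodel.cov_sum_right (hmodel.memLp_emb _ _)]
      have hK : 1 / (L : ℝ) * (Kx'x' *ᵥ one) l = ∑ l', 1 / (L : ℝ) * kx (x' l) (x' l') := by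
        simp [Matrix.mulVec, dotProduct, one, Kx'x', BayesRCFME.gram, Finset.mul_sum]
      have hR' : (Rr'r' *ᵥ α) m = ∑ m', ry (r' m) (r' m') * α m' := rfl
      rw [hK, hR', Finset.sum_mul_sum]
      refine Finset.sum_congr rfl fun l' _ => Finset.sum_congr rfl fun m' _ => ?_
      rw [hmodel.cov_emb]
      ring
    simp only [hc, B]
    rw [mul_comm (α ⬝ᵥ _), mul_assoc, dotProduct, dotProduct, Finset.sum_mul_sum,
      Finset.mul_sum]
    refine Finset.sum_congr rfl fun l _ => ?_
    rw [Finset.mul_sum]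
    refine Finset.sum_congr rfl fun m _ => ?_
    simp only [one]
    ring
  obtain ⟨hσ, hpost⟩ := BayesRCFME.exists_hasPosterior_of_hasGaussianLaw
    (Z := fun i j ω => BayesRCFME.observation lam emb noise x r ω i j)
    (hmodel.hasGaussianLaw_observation_prodMk lam x r x' r' (fun _ m => 1 / (L : ℝ) * α m))
    (hmodel.integral_observation lam x r) (hmodel.integral_sum x' r' _) hQ hRrr
    (hmodel.cov_observation hlam.le x r) hcross (fun i j => k (r i) (r j))
  have hKt : Kx'x = Kxx'ᵀ := (BayesRCFME.gram_transpose hkx x x').symm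
  have hRt : Rr'r = Rrr'ᵀ := (BayesRCFME.gram_transpose hry r r').symm
  -- Symmetry of the kernels gives `Kx'x = Kxx'ᵀ` and `Rr'r = Rrr'ᵀ`, so the subtracted term is a
  -- product of the quadratic forms of `Q⁻¹` at `a` and `Rrr⁻¹` at `b`; the factor `1 / L²` comes
  -- from the two copies of `a`.
  have hvar_eq : σ₂sq = cov[fun ω => ∑ l, ∑ m, (1 / (L : ℝ) * α m) * emb (x' l) ω (r' m),
      fun ω => ∑ l, ∑ m, (1 / (L : ℝ) * α m) * emb (x' l) ω (r' m); P] -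
      (a ⬝ᵥ (Q⁻¹ *ᵥ a)) * (b ⬝ᵥ (Rrr⁻¹ *ᵥ b)) := by
    simp only [σ₂sq, C]
    rw [hvar, hKt, hRt, ← Matrix.mulVec_mulVec, ← Matrix.mulVec_mulVec, ← Matrix.mulVec_mulVec,
      ← Matrix.mulVec_mulVec, BayesRCFME.dotProduct_transpose_mulVec,
      BayesRCFME.dotProduct_transpose_mulVec, ha, Matrix.mulVec_smul, smul_dotProduct,
      dotProduct_smul, smul_eq_mul, smul_eq_mul]
    ring
  have hmean_eq : μ₂ = ∑ i, ∑ j, (Q⁻¹ *ᵥ a) i * (Rrr⁻¹ *ᵥ b) j * k (r i) (r j) := by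
    have h1 : ∑ i, ∑ j, (Q⁻¹ *ᵥ a) i * (Rrr⁻¹ *ᵥ b) j * k (r i) (r j) =
        (Q⁻¹ *ᵥ a) ⬝ᵥ (Krr *ᵥ (Rrr⁻¹ *ᵥ b)) := by
      rw [dotProduct]
      refine Finset.sum_congr rfl fun i _ => ?_
      have hK : (Krr *ᵥ (Rrr⁻¹ *ᵥ b)) i = ∑ j, k (r i) (r j) * (Rrr⁻¹ *ᵥ b) j := rfl
      rw [hK, Finset.mul_sum]
      refine Finset.sum_congr rfl fun j _ => ?_
      ring
    simp only [μ₂]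
    -- Symmetry of `Q⁻¹` lets it pass from the vector on the right of the dot product to `a`.
    rw [h1, hKt, ← Matrix.mulVec_mulVec, ← Matrix.mulVec_mulVec, ← Matrix.mulVec_mulVec,
      ← Matrix.mulVec_mulVec, BayesRCFME.dotProduct_transpose_mulVec, ← hQdef,
      ← BayesRCFME.dotProduct_transpose_mulVec Q⁻¹, hQt, ha,
      smul_dotProduct, smul_eq_mul]
  refine ⟨hvar_eq ▸ hσ, ?_⟩
  rw [hη, hmean_eq]
  simp only [hvar_eq]
  exact hpost
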